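/- **Model.** A source sends status updates to a destination over a slotted HARQ link. Let $r_{max}\in\{0,1,2,\dots\}\cup\{\infty\}$ be the maximum number of retransmissions of a packet, and let $g(r)\in[0,1]$ be the probability that a transmission attempt of a packet with $r$ previous (failed) attempts fails; $g$ is non-increasing and $0<g(0)<1$. Failures in different slots are drawn independently given the numbers of previous attempts. At the beginning of slot $t=1,2,\dots$ the state is $s_t=(\delta_t,r_t)$, where $\delta_t$ is the age of information (AoI) at the destination, that is, the number of slots since the generation of the most recently generated packet decoded so far, and $r_t\in\{0,\dots,r_{max}\}$ is the number of previous attempts of the packet that may be retransmitted ($0$ if there is none). The initial state is $s_1=s_0=(1,0)$. In each slot the source takes an action $a_t\in\{\mathrm i,\mathrm n,\mathrm x\}$: * $\mathrm i$ (idle): the AoI grows by $1$, and a pending failed packet is kept with its number of attempts; * $\mathrm n$ (new update): a packet generated at the beginning of the slot is transmitted, and any pending packet is discarded; it fails with probability $g(0)$; * $\mathrm x$ (retransmission of the pending failed packet, allowed only if $r_t\ge 1$): it fails with probability $g(r_t)$. After a success the AoI becomes the number of slots since the generation of the decoded packet ($1$ for a new packet) and $r_{t+1}=0$. After a failure the AoI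 grows by $1$ and $r_{t+1}$ is the number of attempts of the packet made so far, except that a packet that has failed in its first transmission and in $r_{max}$ retransmissions is dropped, $r_{t+1}=0$. A policy is any history-dependent randomized rule $\pi=\{\pi_t\}$, which maps the past states and actions and the current state to a distribution over the allowed actions. Put $$J^{\pi}(s_0)=\limsup_{T\to\infty}\frac1T\,\mathbb E\Big[\sum_{t=1}^{T}\delta_t^{\pi}\Big],\qquad C^{\pi}(s_0)=\limsup_{T\to\infty}\frac1T\,\mathbb E\Big[\sum_{t=1}^{T}\mathbf 1[a_t^{\pi}\ne\mathrm i]\Big],$$ where $J^\pi(s_0)$ may be $+\infty$. **Proposition.** For every policy $\pi$ there is a policy $\pi'$ (not necessarily distinct from $\pi$) such that $J^{\pi'}(s_0)\le J^{\pi}(s_0)$, $C^{\pi'}(s_0)\le C^{\pi}(s_0)$, and $\pi'$ takes a retransmission action only immediately after a failed transmission: with probability one, whenever $a^{\pi'}_{t}=\mathrm x$, we have $t\ge2$ and in slot $t-1$ a transmission took place and failed. In particular, $\Pr(a^{\pi'}_{t+1}=\mathrm x,\ a^{\pi'}_t=\mathrm i)=0$ for all $t\ge 1$, i.e. $\Pr(a^{\pi'}_{t+1}=\mathrm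 x\mid a^{\pi'}_t=\mathrm i)=0$ whenever the condition has positive probability. -/

import Mathlib

open scoped ENNReal NNReal

namespace HARQ

/-- The actions of the source in a slot: remain idle (`i`), transmit a fresh status update (`n`),
or retransmit the packet whose previous transmission attempts failed (`x`). -/
inductive Action where
  | idle
  | fresh
  | retransmit

/-- The HARQ link. `g r` is the probability that the transmission attempt of a packet with `r`
previous attempts fails, and `rmax` is the maximum number of retransmissions of a packet,
possibly infinite. Only the values `g r` with `r ≤ rmax` are ever used. -/
structure Channel where
  g : ℕ → ℝ≥0
  rmax : ℕ∞
  antitone_g : Antitone g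
  g_zero_pos : 0 < g 0
  g_zero_lt_one : g 0 < 1

/-- The state at the beginning of a slot: `aoi` is the age of information at the destination,
`r` is the number of previous (all failed) transmission attempts of the packet that can be
retransmitted (`0` if there is no such packet), and `pktAge` is the number of slots elapsed since
that packet was generated (`0` if there is no such packet).
The component `pktAge` is a function of the past values of `r` and of the past actions, so
letting a policy see it does not enlarge the class of policies; it makes the dynamics Markov
when the source may stay idle between two attempts of the same packet. -/
@[ext]
structure State where
  aoi : ℕ
  r : ℕ
  pktAge : ℕ

/-- The initial state `(1, 0)`: source and destination are synchronized. -/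
def State.init : State := ⟨1, 0, 0⟩

/-- A sequence of past state-action pairs, the most recent one first. -/
abbrev History := List (State × Action)

namespace Channel

variable (ch : Channel)

theorem g_le_one (r : ℕ) : ch.g r ≤ 1 :=
  (ch.antitone_g (Nat.zero_le r)).trans ch.g_zero_lt_one.le

/-- The outcome of an attempt of a packet with `r` previous attempts: `true` (a failure, NACK) with
probability `g r`, and `false` (a success, ACK) with probability `1 - g r`. -/
noncomputable def attempt (r : ℕ) : PMF Bool :=
  PMF.ofFintype (fun failed => if failed then (ch.g r : ℝ≥0∞) else 1 - (ch.g r : ℝ≥0∞))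
    (by simpa using add_tsub_cancel_of_le (ENNReal.coe_le_one_iff.2 (ch.g_le_one r)))

open Classical in
/-- The state after a failed attempt of a packet. The age of information grows by one; `r` counts
the attempts of the packet including the failed one, and `pktAge` is the age of the packet at the
end of the slot. A packet whose `rmax` retransmissions are used up is dropped. -/
noncomputable def afterFailure (aoi r pktAge : ℕ) : State :=
  if (r : ℕ∞) ≤ ch.rmax then ⟨aoi + 1, r, pktAge⟩ else ⟨aoi + 1, 0, 0⟩

/-- The state after an idle slot: the age of information grows, and a packet that waits for
retransmission is kept, with its number of attempts, and gets older. -/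
def afterIdle (s : State) : State :=
  ⟨s.aoi + 1, s.r, if s.r = 0 then 0 else s.pktAge + 1⟩

/-- The transition law. When a packet is decoded, the age of information becomes the number of
slots elapsed since the generation of this packet. -/
noncomputable def step (s : State) : Action → PMF State
  | .idle => PMF.pure (afterIdle s)
  | .fresh =>
      (ch.attempt 0).map fun failed =>
        if failed then ch.afterFailure s.aoi 1 1 else ⟨1, 0, 0⟩
  | .retransmit =>
      (ch.attempt s.r).map fun failed =>
        if failed then ch.afterFailure s.aoi (s.r + 1) (s.pktAge + 1)
        else ⟨s.pktAge + 1, 0, 0⟩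

end Channel

/-- A (history dependent, randomized) policy: it maps the past states and actions and the current
state to a distribution over the actions. The number of the slot is the length of the history
plus one. A retransmission is not allowed when there is no failed packet to be retransmitted. -/
structure Policy where
  act : History → State → PMF Action
  admissible : ∀ (h : History) (s : State), s.r = 0 → act h s .retransmit = 0

namespace Policy

variable (ch : Channel) (π : Policy)

/-- The joint law of `((s_T, a_T), …, (s_1, a_1))` and `s_{T+1}` under the policy `π`, where `s_1`
is the initial state. -/
noncomputable def law : ℕ → PMF (History × State)
  | 0 => PMF.pure ([], State.init)
  | T + 1 => (law T).bind fun p =>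
      (π.act p.1 p.2).bind fun a =>
        (ch.step p.2 a).map fun s' => ((p.2, a) :: p.1, s')

/-- The sum of the ages of information over the slots of a history. -/
def totalAge (h : History) : ℕ := (h.map fun p => p.1.aoi).sum

/-- The number of transmissions of one state-action pair: `0` if idle and `1` otherwise. -/
def transmissions : State × Action → ℕ
  | (_, .idle) => 0
  | (_, _) => 1

/-- The number of transmissions in the slots of a history. -/
def totalTransmissions (h : History) : ℕ := (h.map transmissions).sum

/-- The expectation, under `π`, of a cost of the history of the first `T` slots. -/
noncomputable def expectedCost (f : History → ℕ) (T : ℕ) : ℝ≥0∞ :=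
  ∑' p : History × State, π.law ch T p * (f p.1 : ℝ≥0∞)

/-- The infinite horizon average age of information `J`, with value `∞` if it is infinite. -/
noncomputable def averageAge : ℝ≥0∞ :=
  Filter.limsup (fun T : ℕ => π.expectedCost ch totalAge T / (T : ℝ≥0∞)) Filter.atTop

/-- The infinite horizon average number of transmissions `C`. -/
noncomputable def averageTransmissions : ℝ≥0∞ :=
  Filter.limsup (fun T : ℕ => π.expectedCost ch totalTransmissions T / (T : ℝ≥0∞)) Filter.atTop

/-- The probability, under `π`, that the history of the first `T` slots satisfies `E`. -/
noncomputable def prob (T : ℕ) (E : History → Prop) : ℝ≥0∞ :=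
  (π.law ch T).toOuterMeasure {p | E p.1}

end Policy

/-- The last action is a retransmission and the action before it is idle. -/
def IdleThenRetransmit (h : History) : Prop :=
  ∃ (s s' : State) (h' : History), h = (s', .retransmit) :: (s, .idle) :: h'

/-- In the last but one slot a transmission took place and it failed, that is, the age of
information grew by one during this slot (it does not grow in a slot in which a packet is
decoded). -/
def PreviousTransmissionFailed (h : History) : Prop :=
  ∃ (s s' : State) (a a' : Action) (h' : History),
    h = (s', a') :: (s, a) :: h' ∧ a ≠ .idle ∧ s'.aoi = s.aoi + 1

/-- The last action is a retransmission. -/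
def LastIsRetransmission (h : History) : Prop :=
  ∃ (s : State) (h' : History), h = (s, .retransmit) :: h'

end HARQ

/-! Idling and retransmitting commute: the failure probability depends only on the number of
attempts, and packet and destination age alike whether the waiting precedes or follows the attempt
(`step_retransmit_iterate_afterIdle`). So `π'` can simulate `π` ahead of time. After each
transmission it draws how long `π` would now idle and what it would then send (`plan`). A
retransmission is made at once, and the skipped idle slots are added to a lag; a new packet is sent
only after the lag has been idled away, when the true and the simulated state coincide again.

Retransmitting early does not increase the total age, because the pending packet is never older than
the age at the destination. At a fixed horizon the simulation may have made transmissions that `π`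
makes only later, but these are retransmissions of a single packet, in expectation at most `1 / (1 -
g 0)`; this constant disappears in the time average. The comparison is `expect_draw_simValue_le`, an
induction on the remaining slots that treats both costs at once through `IsExcess`.

The draws are hidden from the observed history. `exists_policy_of_hidden` turns the simulation into
a policy by taking the conditional law of the action given what is observed, which leaves the law of
the histories unchanged. -/

namespace HARQ

/-! ### Expectations with respect to probability mass functions -/

/-- The expectation of a function with values in `[0, ∞]`. -/
noncomputable def expect {α : Type*} (p : PMF α) (f : α → ℝ≥0∞) : ℝ≥0∞ := ∑' x, p x * f x

section Expect

variable {α β : Type*}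

theorem expect_pure (a : α) (f : α → ℝ≥0∞) : expect (PMF.pure a) f = f a := by
  rw [expect, tsum_eq_single a]
  · simp
  · intro b hb
    simp [hb]

theorem expect_bind (p : PMF α) (q : α → PMF β) (f : β → ℝ≥0∞) :
    expect (p.bind q) f = expect p fun a => expect (q a) f := by
  simp only [expect, PMF.bind_apply, ← ENNReal.tsum_mul_right, ← ENNReal.tsum_mul_left]
  rw [ENNReal.tsum_comm]
  simp only [mul_assoc]

theorem expect_map (p : PMF α) (g : α → β) (f : β → ℝ≥0∞) :
    expect (p.map g) f = expect p fun a => f (g a) := by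
  rw [← PMF.bind_pure_comp, expect_bind]
  simp only [Function.comp_apply, expect_pure]

theorem expect_add (p : PMF α) (f g : α → ℝ≥0∞) :
    (expect p fun a => f a + g a) = expect p f + expect p g := by
  simp only [expect, mul_add, ENNReal.tsum_add]

theorem expect_const (p : PMF α) (c : ℝ≥0∞) : (expect p fun _ => c) = c := by
  rw [expect, ENNReal.tsum_mul_right, p.tsum_coe, one_mul]

theorem expect_mono {p : PMF α} {f g : α → ℝ≥0∞} (h : ∀ a ∈ p.support, f a ≤ g a) :
    expect p f ≤ expect p g := by
  refine ENNReal.tsum_le_tsum fun a => ?_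
  by_cases ha : p a = 0
  · simp [ha]
  · exact mul_le_mul_right (h a ha) _

theorem expect_congr {p : PMF α} {f g : α → ℝ≥0∞} (h : ∀ a ∈ p.support, f a = g a) :
    expect p f = expect p g :=
  le_antisymm (expect_mono fun a ha => (h a ha).le) (expect_mono fun a ha => (h a ha).ge)

theorem expect_const_add (p : PMF α) (c : ℝ≥0∞) (f : α → ℝ≥0∞) :
    (expect p fun a => c + f a) = c + expect p f := by
  rw [expect_add, expect_const]

theorem tsum_option_eq (f : Option α → ℝ≥0∞) : ∑' o, f o = f none + ∑' a, f (some a) := by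
  rw [← (Equiv.optionEquivSumPUnit.{0, _} α).symm.tsum_eq,
    Summable.tsum_sum (f := fun x => f ((Equiv.optionEquivSumPUnit.{0, _} α).symm x))
      ENNReal.summable ENNReal.summable, add_comm]
  simp

theorem expect_option (p : PMF (Option α)) (f : Option α → ℝ≥0∞) :
    expect p f = p none * f none + ∑' a, p (some a) * f (some a) :=
  tsum_option_eq _

theorem tsum_action (f : Action → ℝ≥0∞) :
    ∑' a, f a = f .idle + f .fresh + f .retransmit := by
  rw [tsum_eq_sum (s := ⟨{.idle, .fresh, .retransmit}, by simp⟩)]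
  · simp [Finset.sum, add_assoc]
  · rintro (_ | _ | _) h <;> simp at h

theorem expect_action (p : PMF Action) (f : Action → ℝ≥0∞) :
    expect p f = p .idle * f .idle + p .fresh * f .fresh + p .retransmit * f .retransmit :=
  tsum_action _

/-- The expected cost of the first `n` steps of a Markov chain with transition law `κ`, where `w x`
is the expected cost of a step from `x`. -/
noncomputable def costToGo (κ : α → PMF α) (w : α → ℝ≥0∞) : ℕ → α → ℝ≥0∞
  | 0, _ => 0
  | n + 1, x => w x + expect (κ x) (costToGo κ w n)

/-- Replaces the expected cost accumulated in the past by a backward recursion from an arbitrary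
starting point, on which one can induct. -/
theorem expect_law_eq_costToGo {κ : α → PMF α} {w f : α → ℝ≥0∞} {L : ℕ → PMF α}
    (hL : ∀ T, L (T + 1) = (L T).bind κ) (hf : ∀ x, expect (κ x) f = f x + w x) (n : ℕ) :
    expect (L n) f = expect (L 0) fun x => f x + costToGo κ w n x := by
  suffices h : ∀ n T, expect (L (T + n)) f = expect (L T) fun x => f x + costToGo κ w n x by
    simpa using h n 0
  intro n
  induction n with
  | zero => intro T; simp [costToGo]
  | succ n ih =>
    intro T
    rw [← add_assoc, add_right_comm, ih, hL, expect_bind]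
    refine congrArg _ (funext fun x => ?_)
    rw [expect_add, hf, costToGo, add_assoc]

end Expect

/-! ### Policies with a hidden memory -/

section Disintegration

variable {X Y Z : Type*}

open Classical in
/-- The conditional law of a random element given the value of a function of it, or a default law
where this value has probability zero. -/
noncomputable def condLaw (p : PMF X) (ρ : X → Y) (α : X → Z) (z : Z) (y : Y) : PMF Z :=
  if h : ∃ x ∈ ρ ⁻¹' {y}, x ∈ p.support then (p.filter _ h).map α else PMF.pure z

theorem map_mul_filter (p : PMF X) (ρ : X → Y) (x : X)
    (h : ∃ x' ∈ ρ ⁻¹' {ρ x}, x' ∈ p.support) :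
    p.map ρ (ρ x) * p.filter _ h x = p x := by
  classical
  have hm : p.map ρ (ρ x) = ∑' x', (ρ ⁻¹' {ρ x}).indicator p x' := by
    rw [PMF.map_apply]
    refine tsum_congr fun x' => ?_
    simp [Set.indicator_apply, eq_comm]
  rw [PMF.filter_apply, ← hm, Set.indicator_of_mem (by simp), mul_comm, mul_assoc]
  rw [ENNReal.inv_mul_cancel, mul_one]
  · obtain ⟨x', hx', hx⟩ := h
    have : ρ x ∈ (p.map ρ).support := by
      rw [PMF.mem_support_map_iff]; exact ⟨x', hx, hx'⟩
    exact this
  · exact PMF.apply_ne_top _ _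

theorem map_bind_condLaw (p : PMF X) (ρ : X → Y) (α : X → Z) (z : Z) :
    (p.map ρ).bind (fun y => (condLaw p ρ α z y).map fun a => (y, a)) =
      p.map fun x => (ρ x, α x) := by
  classical
  ext ⟨y, a⟩
  rw [PMF.bind_apply, tsum_eq_single y]
  · by_cases h : ∃ x ∈ ρ ⁻¹' {y}, x ∈ p.support
    · simp only [condLaw, dif_pos h, PMF.map_comp]
      rw [PMF.map_apply _ (p.filter _ h), PMF.map_apply _ p (y, a), ← ENNReal.tsum_mul_left]
      refine tsum_congr fun x => ?_
      by_cases hx : ρ x = y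
      · subst hx
        simp only [Function.comp_apply, mul_ite, mul_zero, map_mul_filter p ρ x h, Prod.mk.injEq,
          true_and]
      · rw [PMF.filter_apply_eq_zero_of_notMem _ (by simpa using hx)]
        simp [Ne.symm hx]
    · have h0 : p.map ρ y = 0 := by
        by_contra hne
        have : y ∈ (p.map ρ).support := hne
        rw [PMF.mem_support_map_iff] at this
        obtain ⟨x, hx, hxy⟩ := this
        exact h ⟨x, hxy, hx⟩
      rw [h0, zero_mul, eq_comm]
      by_contra hne
      have : (y, a) ∈ (p.map fun x => (ρ x, α x)).support := hne
      rw [PMF.mem_support_map_iff] at this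
      obtain ⟨x, hx, hxy⟩ := this
      exact h ⟨x, by simpa using congrArg Prod.fst hxy, hx⟩
  · intro y' hy'
    have : ((condLaw p ρ α z y').map fun a => (y', a)) (y, a) = 0 := by
      rw [PMF.apply_eq_zero_iff, PMF.mem_support_map_iff]
      rintro ⟨b, -, hb⟩
      exact hy' (congrArg Prod.fst hb)
    rw [this, mul_zero]

end Disintegration

theorem Policy.length_of_mem_support_law (ch : Channel) (π : Policy) (T : ℕ) :
    ∀ p ∈ (π.law ch T).support, p.1.length = T := by
  induction T with
  | zero =>
    intro p hp
    simp only [Policy.law, PMF.mem_support_pure_iff] at hp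
    simp [hp]
  | succ T ih =>
    intro p hp
    simp only [Policy.law, PMF.mem_support_bind_iff, PMF.mem_support_map_iff] at hp
    obtain ⟨q, hq, a, -, s, -, rfl⟩ := hp
    simp [ih q hq]

/-- A process whose actions are functions of a hidden state, and whose state moves according to the
channel given the past, has the law of a policy. -/
theorem exists_policy_of_hidden {X : Type*} (ch : Channel) (L : ℕ → PMF X)
    (ρ : X → History × State) (α : X → Action)
    (h0 : (L 0).map ρ = PMF.pure ([], State.init))
    (hstep : ∀ T, (L (T + 1)).map ρ = (L T).bind fun x =>
      (ch.step (ρ x).2 (α x)).map fun s' => (((ρ x).2, α x) :: (ρ x).1, s'))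
    (hadm : ∀ T, ∀ x ∈ (L T).support, (ρ x).2.r = 0 → α x ≠ .retransmit) :
    ∃ π : Policy, ∀ T, π.law ch T = (L T).map ρ := by
  have hadm' : ∀ (h : History) (s : State), s.r = 0 →
      condLaw (L h.length) ρ α .idle (h, s) .retransmit = 0 := by
    intro h s hs
    rw [PMF.apply_eq_zero_iff, condLaw]
    split_ifs with hx
    · rw [PMF.mem_support_map_iff]
      rintro ⟨x, hx', ha⟩
      rw [PMF.mem_support_filter_iff] at hx'
      obtain ⟨hxs, hxp⟩ := hx'
      refine hadm _ x hxp ?_ ha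
      have : ρ x = (h, s) := hxs
      rw [this, hs]
    · simp
  -- A history reached after `T` slots has length `T`, so its length selects the law to condition
  -- on. Idling, the default on null histories, is always admissible.
  refine ⟨⟨fun h s => condLaw (L h.length) ρ α .idle (h, s), hadm'⟩, fun T => ?_⟩
  induction T with
  | zero => rw [h0]; rfl
  | succ T ih =>
    have hlen := Policy.length_of_mem_support_law ch
      ⟨fun h s => condLaw (L h.length) ρ α .idle (h, s), hadm'⟩ T
    rw [ih] at hlen
    rw [hstep, Policy.law, ih]
    let G : (History × State) × Action → PMF (History × State) := fun q =>
      (ch.step q.1.2 q.2).map fun s' => ((q.1.2, q.2) :: q.1.1, s')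
    have key : ((L T).map ρ).bind
        (fun y => (condLaw (L T) ρ α .idle y).bind fun a => G (y, a)) =
          (L T).bind fun x => G (ρ x, α x) := by
      have h := congrArg (fun p => p.bind G) (map_bind_condLaw (L T) ρ α .idle)
      simp only [PMF.bind_bind] at h
      rw [PMF.bind_map (L T) _ G] at h
      exact (congrArg _ (funext fun y => (PMF.bind_map _ _ G).symm)).trans h
    refine Eq.trans ?_ key
    ext q
    simp only [PMF.bind_apply]
    refine tsum_congr fun p => ?_
    by_cases hp : (L T).map ρ p = 0
    · simp [hp]
    · rw [hlen p hp]

/-! ### Runs of idle slots -/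

open Channel (afterIdle)

theorem aoi_iterate_afterIdle (d : ℕ) (s : State) : (afterIdle^[d] s).aoi = s.aoi + d := by
  induction d with
  | zero => rfl
  | succ d ih => rw [Function.iterate_succ_apply', afterIdle, ih, add_assoc]

theorem r_iterate_afterIdle (d : ℕ) (s : State) : (afterIdle^[d] s).r = s.r := by
  induction d with
  | zero => rfl
  | succ d ih => rw [Function.iterate_succ_apply', afterIdle, ih]

theorem pktAge_iterate_afterIdle {s : State} (hs : s.r ≠ 0) (d : ℕ) :
    (afterIdle^[d] s).pktAge = s.pktAge + d := by
  induction d with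
  | zero => rfl
  | succ d ih =>
    rw [Function.iterate_succ_apply', afterIdle, r_iterate_afterIdle, if_neg hs, ih, add_assoc]

theorem pktAge_le_aoi_iterate_afterIdle {s : State} (hs : s.pktAge ≤ s.aoi) (d : ℕ) :
    (afterIdle^[d] s).pktAge ≤ (afterIdle^[d] s).aoi := by
  induction d with
  | zero => exact hs
  | succ d ih =>
    rw [Function.iterate_succ_apply']
    simp only [afterIdle]
    split_ifs <;> omega

theorem iterate_afterIdle_eq_of_r_eq_zero (d a : ℕ) : afterIdle^[d] ⟨a, 0, 0⟩ = ⟨a + d, 0, 0⟩ := by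
  induction d with
  | zero => rfl
  | succ d ih => rw [Function.iterate_succ_apply', ih]; simp [afterIdle, add_assoc]

theorem iterate_afterIdle_afterFailure (ch : Channel) (d a r p : ℕ) :
    afterIdle^[d] (ch.afterFailure a (r + 1) p) = ch.afterFailure (a + d) (r + 1) (p + d) := by
  unfold Channel.afterFailure
  split_ifs with h
  · ext
    · simp [aoi_iterate_afterIdle]; ring
    · simp [r_iterate_afterIdle]
    · rw [pktAge_iterate_afterIdle (by simp)]
  · rw [iterate_afterIdle_eq_of_r_eq_zero, add_right_comm]

/-- Idling before a retransmission or after it makes no difference. -/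
theorem step_retransmit_iterate_afterIdle (ch : Channel) {s : State} (hs : s.r ≠ 0) (d : ℕ) :
    ch.step (afterIdle^[d] s) .retransmit = (ch.step s .retransmit).map afterIdle^[d] := by
  simp only [Channel.step, PMF.map_comp, r_iterate_afterIdle, aoi_iterate_afterIdle,
    pktAge_iterate_afterIdle hs]
  refine congrArg (fun f => PMF.map f _) (funext fun b => ?_)
  cases b
  · simp [iterate_afterIdle_eq_of_r_eq_zero]; ring
  · simp [iterate_afterIdle_afterFailure]; ring_nf

/-- The history after `k` more idle slots. -/
def idleHistory : ℕ → History → State → History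
  | 0, h, _ => h
  | k + 1, h, s => idleHistory k ((s, .idle) :: h) (afterIdle s)

/-! ### The state after a slot -/

theorem mem_support_step_of_ne_idle {ch : Channel} {s s' : State} {a : Action} (ha : a ≠ .idle)
    (h : s' ∈ (ch.step s a).support) :
    (∃ r p, s' = ch.afterFailure s.aoi r p ∧ p ≤ s.pktAge + 1) ∨
      ∃ m, s' = ⟨m + 1, 0, 0⟩ ∧ m ≤ s.pktAge := by
  cases a with
  | idle => exact absurd rfl ha
  | fresh =>
    simp only [Channel.step, PMF.mem_support_map_iff] at h
    obtain ⟨b, -, rfl⟩ := h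
    cases b
    · exact .inr ⟨0, by simp⟩
    · exact .inl ⟨1, 1, by simp⟩
  | retransmit =>
    simp only [Channel.step, PMF.mem_support_map_iff] at h
    obtain ⟨b, -, rfl⟩ := h
    cases b
    · exact .inr ⟨s.pktAge, by simp⟩
    · exact .inl ⟨s.r + 1, s.pktAge + 1, by simp⟩

theorem aoi_afterFailure (ch : Channel) (a r p : ℕ) : (ch.afterFailure a r p).aoi = a + 1 := by
  unfold Channel.afterFailure; split_ifs <;> rfl

theorem pktAge_afterFailure_le (ch : Channel) (a r p : ℕ) : (ch.afterFailure a r p).pktAge ≤ p := by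
  unfold Channel.afterFailure; split_ifs <;> simp

theorem pktAge_le_aoi_of_mem_support_step {ch : Channel} {s s' : State} {a : Action}
    (hs : s.pktAge ≤ s.aoi) (h : s' ∈ (ch.step s a).support) : s'.pktAge ≤ s'.aoi := by
  by_cases ha : a = .idle
  · subst ha
    simp only [Channel.step, PMF.mem_support_pure_iff] at h
    subst h
    simp only [afterIdle]
    split_ifs <;> omega
  · obtain ⟨r, p, rfl, hp⟩ | ⟨m, rfl, hm⟩ := mem_support_step_of_ne_idle ha h
    · rw [aoi_afterFailure]
      exact (pktAge_afterFailure_le ..).trans (by omega)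
    · simp

theorem aoi_le_of_mem_support_step {ch : Channel} {s s' : State} {a : Action}
    (hs : s.pktAge ≤ s.aoi) (h : s' ∈ (ch.step s a).support) : s'.aoi ≤ s.aoi + 1 := by
  by_cases ha : a = .idle
  · subst ha
    simp only [Channel.step, PMF.mem_support_pure_iff] at h
    subst h
    simp [afterIdle]
  · obtain ⟨r, p, rfl, hp⟩ | ⟨m, rfl, hm⟩ := mem_support_step_of_ne_idle ha h
    · rw [aoi_afterFailure]
    · simp; omega

/-- A packet still pending after a transmission certifies a failure, since decoding resets `r` to
zero. -/
theorem aoi_eq_of_mem_support_step {ch : Channel} {s s' : State} {a : Action} (ha : a ≠ .idle)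
    (h : s' ∈ (ch.step s a).support) (hr : s'.r ≠ 0) : s'.aoi = s.aoi + 1 := by
  obtain ⟨r, p, rfl, hp⟩ | ⟨m, rfl, hm⟩ := mem_support_step_of_ne_idle ha h
  · rw [aoi_afterFailure]
  · simp at hr

/-! ### The next transmission of a policy -/

namespace Policy

variable (π : Policy)

/-- The probability that the policy remains idle for exactly `k` slots and then takes the
action `c`, which is not to be idle. -/
noncomputable def planMass : ℕ → Action → History → State → ℝ≥0∞
  | 0, .idle, _, _ => 0
  | 0, .fresh, h, s => π.act h s .fresh
  | 0, .retransmit, h, s => π.act h s .retransmit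
  | k + 1, c, h, s => π.act h s .idle * planMass k c ((s, .idle) :: h) (afterIdle s)

theorem tsum_act (h : History) (s : State) :
    π.act h s .idle + π.act h s .fresh + π.act h s .retransmit = 1 := by
  rw [← tsum_action, PMF.tsum_coe]

theorem sum_planMass_le_one (N : ℕ) :
    ∀ h s, ∑ k ∈ Finset.range N, ∑' c, π.planMass k c h s ≤ 1 := by
  induction N with
  | zero => simp
  | succ N ih =>
    intro h s
    rw [Finset.sum_range_succ']
    simp only [planMass, ENNReal.tsum_mul_left, ← Finset.mul_sum]
    rw [tsum_action]
    simp only [planMass, zero_add]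
    rw [← π.tsum_act h s, add_assoc]
    gcongr
    exact mul_le_of_le_one_right' (ih _ _)

/-- The probability that the policy does not remain idle for ever. -/
noncomputable def planTotal (h : History) (s : State) : ℝ≥0∞ :=
  ∑' p : ℕ × Action, π.planMass p.1 p.2 h s

theorem planTotal_eq (h : History) (s : State) :
    π.planTotal h s = ∑' k, ∑' c, π.planMass k c h s :=
  ENNReal.tsum_prod (f := fun k c => π.planMass k c h s)

theorem planTotal_le_one (h : History) (s : State) : π.planTotal h s ≤ 1 := by
  rw [planTotal_eq]
  exact ENNReal.tsum_le_of_sum_range_le fun N => π.sum_planMass_le_one N h s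

theorem tsum_planMass_mul (h : History) (s : State) (G : ℕ × Action → ℝ≥0∞) :
    ∑' p : ℕ × Action, π.planMass p.1 p.2 h s * G p =
      π.act h s .idle * (∑' p : ℕ × Action,
        π.planMass p.1 p.2 ((s, .idle) :: h) (afterIdle s) * G (p.1 + 1, p.2)) +
        π.act h s .fresh * G (0, .fresh) + π.act h s .retransmit * G (0, .retransmit) := by
  rw [ENNReal.tsum_prod', ENNReal.tsum_prod', tsum_eq_zero_add' ENNReal.summable, tsum_action]
  simp only [planMass, mul_assoc, ENNReal.tsum_mul_left]
  ring

theorem planTotal_rec (h : History) (s : State) :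
    π.planTotal h s = π.act h s .idle * π.planTotal ((s, .idle) :: h) (afterIdle s) +
        π.act h s .fresh + π.act h s .retransmit := by
  simpa [planTotal] using π.tsum_planMass_mul h s fun _ => 1

/-- The probability that the policy remains idle for ever. -/
theorem one_sub_planTotal (h : History) (s : State) :
    1 - π.planTotal h s =
      π.act h s .idle * (1 - π.planTotal ((s, .idle) :: h) (afterIdle s)) := by
  have h1 := π.planTotal_le_one ((s, .idle) :: h) (afterIdle s)
  have hfin : π.planTotal h s ≠ ∞ := ne_top_of_le_ne_top ENNReal.one_ne_top (π.planTotal_le_one h s)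
  refine ENNReal.sub_eq_of_eq_add hfin ?_
  rw [π.planTotal_rec h s, add_assoc, ← add_assoc, ← mul_add, tsub_add_cancel_of_le h1, mul_one,
    ← add_assoc, tsum_act]

/-- The law of the number of idle slots before the next transmission and of the kind of this
transmission; `none` if there is no further transmission. -/
noncomputable def plan (h : History) (s : State) : PMF (Option (ℕ × Action)) :=
  ⟨fun o => o.elim (1 - π.planTotal h s) fun p => π.planMass p.1 p.2 h s, by
    rw [ENNReal.summable.hasSum_iff, tsum_option_eq]
    exact tsub_add_cancel_of_le (π.planTotal_le_one h s)⟩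

theorem expect_plan (h : History) (s : State) (G : Option (ℕ × Action) → ℝ≥0∞) :
    expect (π.plan h s) G = (1 - π.planTotal h s) * G none +
      ∑' p : ℕ × Action, π.planMass p.1 p.2 h s * G (some p) :=
  expect_option _ _

theorem expect_plan_rec (h : History) (s : State) (G : Option (ℕ × Action) → ℝ≥0∞) :
    expect (π.plan h s) G =
      π.act h s .idle * expect (π.plan ((s, .idle) :: h) (afterIdle s))
        (fun o => G (o.map fun p => (p.1 + 1, p.2))) +
        π.act h s .fresh * G (some (0, .fresh)) +
          π.act h s .retransmit * G (some (0, .retransmit)) := by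
  rw [expect_plan, expect_plan, tsum_planMass_mul, one_sub_planTotal]
  simp only [Option.map_none, Option.map_some]
  ring

/-- Idling preserves `r`, so a retransmission planned for later is already allowed now. -/
theorem r_ne_zero_of_planMass_ne_zero (k : ℕ) :
    ∀ h s, π.planMass k .retransmit h s ≠ 0 → s.r ≠ 0 := by
  induction k with
  | zero => exact fun h s hp hr => hp (π.admissible h s hr)
  | succ k ih =>
    intro h s hp
    exact ih ((s, .idle) :: h) (afterIdle s) (right_ne_zero_of_mul hp)

end Policy

/-! ### Retransmitting without delay -/

/-- A state of the source that simulates a policy ahead of time. The simulated policy has the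
history `sim`, its state is the one after `lag` more idle slots, and its next action is `next`;
it is idle for ever if `next` is idle. The true history and state are `hist` and `st`. -/
structure SimState where
  sim : History
  lag : ℕ
  next : Action
  hist : History
  st : State

namespace SimState

/-- A simulated retransmission takes place at once, and a simulated new transmission after the
idle slots before it. -/
def action : SimState → Action
  | ⟨_, _, .retransmit, _, _⟩ => .retransmit
  | ⟨_, 0, .fresh, _, _⟩ => .fresh
  | _ => .idle

/-- The true history and state. -/
def past (y : SimState) : History × State := (y.hist, y.st)

/-- The simulation after its next transmission has been drawn. -/
def resume (hv : History) (d : ℕ) (h : History) (s : State) : Option (ℕ × Action) → SimState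
  | none => ⟨[], 0, .idle, h, s⟩
  | some (k, c) => ⟨idleHistory k hv (afterIdle^[d] s), d + k, c, h, s⟩

end SimState

namespace Policy

variable (ch : Channel) (π : Policy)

/-- Draw the next transmission of the simulated policy. -/
noncomputable def draw (hv : History) (d : ℕ) (h : History) (s : State) : PMF SimState :=
  (π.plan hv (afterIdle^[d] s)).map (SimState.resume hv d h s)

/-- The law of the simulation after a slot in which the true state has become `s'`. -/
noncomputable def update : SimState → State → PMF SimState
  | ⟨hv, d, .retransmit, h, s⟩, s' =>
      π.draw ((afterIdle^[d] s, .retransmit) :: hv) d ((s, .retransmit) :: h) s'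
  | ⟨hv, 0, .fresh, h, s⟩, s' => π.draw ((s, .fresh) :: hv) 0 ((s, .fresh) :: h) s'
  | ⟨hv, d + 1, .fresh, h, s⟩, s' => PMF.pure ⟨hv, d, .fresh, (s, .idle) :: h, s'⟩
  | ⟨hv, d, .idle, h, s⟩, s' => PMF.pure ⟨hv, d, .idle, (s, .idle) :: h, s'⟩

/-- The transition law of the simulation. -/
noncomputable def simKernel (y : SimState) : PMF SimState :=
  (ch.step y.st y.action).bind (π.update y)

/-- The law of the simulation after `T` slots. -/
noncomputable def simLaw : ℕ → PMF SimState
  | 0 => π.draw [] 0 [] State.init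
  | T + 1 => (simLaw T).bind (π.simKernel ch)

theorem mem_support_draw {hv : History} {d : ℕ} {h : History} {s : State} {y : SimState}
    (hy : y ∈ (π.draw hv d h s).support) :
    y.hist = h ∧ y.st = s ∧ (y.next = .idle ∨ d ≤ y.lag) ∧ (y.next = .retransmit → s.r ≠ 0) := by
  rw [draw, PMF.mem_support_map_iff] at hy
  obtain ⟨_ | ⟨k, c⟩, ho, rfl⟩ := hy
  · simp [SimState.resume]
  · refine ⟨rfl, rfl, .inr (Nat.le_add_right d k), ?_⟩
    rintro rfl
    have := π.r_ne_zero_of_planMass_ne_zero k hv (afterIdle^[d] s) ho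
    rwa [r_iterate_afterIdle] at this

theorem map_past_draw (hv : History) (d : ℕ) (h : History) (s : State) :
    (π.draw hv d h s).map SimState.past = PMF.pure (h, s) := by
  rw [draw, PMF.map_comp, ← PMF.map_const (π.plan hv (afterIdle^[d] s)) (h, s)]
  refine congrArg (fun f => PMF.map f _) (funext fun o => ?_)
  cases o <;> rfl

/-- The draw affects only the hidden components; hence the observed part moves by the channel alone,
as `exists_policy_of_hidden` requires. -/
theorem map_past_update (y : SimState) (s' : State) :
    (π.update y s').map SimState.past = PMF.pure ((y.st, y.action) :: y.hist, s') := by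
  obtain ⟨hv, d, c, h, s⟩ := y
  cases c
  · exact PMF.pure_map _ _
  · cases d
    · exact π.map_past_draw _ _ _ _
    · exact PMF.pure_map _ _
  · exact π.map_past_draw _ _ _ _

theorem map_past_simLaw_succ (T : ℕ) :
    (π.simLaw ch (T + 1)).map SimState.past = (π.simLaw ch T).bind fun y =>
      (ch.step y.past.2 y.action).map fun s' => ((y.past.2, y.action) :: y.past.1, s') := by
  rw [simLaw, PMF.map_bind]
  refine congrArg _ (funext fun y => ?_)
  rw [simKernel, PMF.map_bind]
  simp only [map_past_update]
  rfl

/-- The true states that occur in the simulation. -/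
structure SimInvariant (y : SimState) : Prop where
  failed : y.next = .retransmit → y.st.r ≠ 0 ∧
    ∃ s a h, y.hist = (s, a) :: h ∧ a ≠ .idle ∧ y.st.aoi = s.aoi + 1
  hist : LastIsRetransmission y.hist → PreviousTransmissionFailed y.hist

theorem simInvariant_of_mem_support_simLaw (T : ℕ) :
    ∀ y ∈ (π.simLaw ch T).support, SimInvariant y := by
  induction T with
  | zero =>
    intro y hy
    obtain ⟨h1, h2, -, h4⟩ := π.mem_support_draw hy
    refine ⟨fun hn => absurd rfl (h4 hn), ?_⟩
    rw [h1]
    rintro ⟨s, h, hh⟩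
    simp at hh
  | succ T ih =>
    intro y' hy'
    simp only [simLaw, PMF.mem_support_bind_iff, simKernel] at hy'
    obtain ⟨y, hy, s', hs', hu⟩ := hy'
    have hI := ih y hy
    have hpast : y'.past = ((y.st, y.action) :: y.hist, s') := by
      have : y'.past ∈ ((π.update y s').map SimState.past).support := by
        rw [PMF.mem_support_map_iff]; exact ⟨y', hu, rfl⟩
      rwa [map_past_update, PMF.mem_support_pure_iff] at this
    have hhist : y'.hist = (y.st, y.action) :: y.hist := congrArg Prod.fst hpast
    have hst : y'.st = s' := congrArg Prod.snd hpast
    -- A retransmission becomes the next action only through a draw, and during the run draws follow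
    -- transmissions only.
    have key : y'.next = .retransmit → y.action ≠ .idle ∧ s'.r ≠ 0 := by
      intro hn
      obtain ⟨hv, d, c, h, s⟩ := y
      cases c with
      | idle =>
        have := (PMF.mem_support_pure_iff _ _).1 hu
        simp [this] at hn
      | fresh =>
        cases d with
        | zero => exact ⟨Action.noConfusion, (π.mem_support_draw hu).2.2.2 hn⟩
        | succ d =>
          have := (PMF.mem_support_pure_iff _ _).1 hu
          simp [this] at hn
      | retransmit => exact ⟨Action.noConfusion, (π.mem_support_draw hu).2.2.2 hn⟩
    refine ⟨fun hn => ?_, ?_⟩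
    · obtain ⟨ha, hr⟩ := key hn
      rw [hst]
      exact ⟨hr, _, _, _, hhist, ha, aoi_eq_of_mem_support_step ha hs' hr⟩
    · rw [hhist]
      rintro ⟨s, h, hh⟩
      have ha : y.action = .retransmit := by simp_all
      have hn : y.next = .retransmit := by
        obtain ⟨hv, d, c, h, s⟩ := y
        cases c <;> cases d <;> first | rfl | cases ha
      obtain ⟨-, s0, a0, h0, h1, h2, h3⟩ := hI.failed hn
      exact ⟨s0, y.st, a0, y.action, h0, by rw [h1], h2, h3⟩

theorem exists_policy_of_simLaw :
    ∃ π' : Policy, ∀ T, π'.law ch T = (π.simLaw ch T).map SimState.past := by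
  refine exists_policy_of_hidden ch (π.simLaw ch) SimState.past SimState.action
    (π.map_past_draw _ _ _ _) (π.map_past_simLaw_succ ch) fun T y hy hr ha => ?_
  refine ((π.simInvariant_of_mem_support_simLaw ch T y hy).failed ?_).1 hr
  obtain ⟨hv, d, c, h, s⟩ := y
  cases c <;> cases d <;> first | rfl | cases ha

/-! ### Comparison of the costs -/

/-- The transition law of the history and the state. -/
noncomputable def kernel (p : History × State) : PMF (History × State) :=
  (π.act p.1 p.2).bind fun a => (ch.step p.2 a).map fun s' => ((p.2, a) :: p.1, s')

/-- The sum over the slots of a history of a cost per slot. -/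
def total (w : State × Action → ℕ) (h : History) : ℕ := (h.map w).sum

theorem expectedCost_eq (w : State × Action → ℕ) (T : ℕ) :
    π.expectedCost ch (total w) T = costToGo (π.kernel ch)
      (fun p => expect (π.act p.1 p.2) fun a => (w (p.2, a) : ℝ≥0∞)) T ([], State.init) := by
  have h := expect_law_eq_costToGo (κ := π.kernel ch)
    (w := fun p => expect (π.act p.1 p.2) fun a => (w (p.2, a) : ℝ≥0∞))
    (f := fun p => (total w p.1 : ℝ≥0∞)) (L := π.law ch) (fun T => rfl) (fun p => ?_) T
  · refine h.trans ?_
    rw [show π.law ch 0 = PMF.pure ([], State.init) from rfl, expect_pure]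
    simp [total]
  · simp only [kernel, expect_bind, expect_map, expect_const, total, List.map_cons, List.sum_cons,
      Nat.cast_add]
    rw [expect_add, expect_const, add_comm]

theorem expect_simLaw_eq (w : State × Action → ℕ) (T : ℕ) :
    (expect (π.simLaw ch T) fun y => (total w y.hist : ℝ≥0∞)) =
      expect (π.draw [] 0 [] State.init)
        (costToGo (π.simKernel ch) (fun y => (w (y.st, y.action) : ℝ≥0∞)) T) := by
  have h := expect_law_eq_costToGo (κ := π.simKernel ch)
    (w := fun y => (w (y.st, y.action) : ℝ≥0∞))
    (f := fun y => (total w y.hist : ℝ≥0∞)) (L := π.simLaw ch) (fun T => rfl) (fun y => ?_) T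
  · refine h.trans (expect_congr fun y hy => ?_)
    rw [(π.mem_support_draw hy).1]
    simp [total]
  · rw [simKernel, expect_bind]
    have : ∀ s', (expect (π.update y s') fun y => (total w y.hist : ℝ≥0∞)) =
        total w y.hist + w (y.st, y.action) := by
      intro s'
      refine (expect_map (π.update y s') SimState.past fun p => (total w p.1 : ℝ≥0∞)).symm.trans ?_
      rw [map_past_update, expect_pure]
      simp [total, add_comm]
    simp only [this, expect_const]

theorem expectedCost_eq_of_law_eq {π' : Policy}
    (h : ∀ T, π'.law ch T = (π.simLaw ch T).map SimState.past) (w : State × Action → ℕ) (T : ℕ) :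
    π'.expectedCost ch (total w) T = expect (π.draw [] 0 [] State.init)
        (costToGo (π.simKernel ch) (fun y => (w (y.st, y.action) : ℝ≥0∞)) T) := by
  rw [← expect_simLaw_eq]
  change expect (π'.law ch T) (fun p => (total w p.1 : ℝ≥0∞)) = _
  rw [h, expect_map]
  rfl

/-- Revealing the plan one idle slot at a time produces the same three branches as the first action
of the simulated policy, so the two sides can be compared branch by branch. -/
theorem expect_draw_rec (hv : History) (d : ℕ) (h : History) (s : State) (U : SimState → ℝ≥0∞) :
    expect (π.draw hv d h s) U =
      π.act hv (afterIdle^[d] s) .idle *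
        expect (π.draw ((afterIdle^[d] s, .idle) :: hv) (d + 1) h s) U +
      π.act hv (afterIdle^[d] s) .fresh * U ⟨hv, d, .fresh, h, s⟩ +
      π.act hv (afterIdle^[d] s) .retransmit * U ⟨hv, d, .retransmit, h, s⟩ := by
  rw [draw, draw, expect_map, expect_plan_rec, expect_map, Function.iterate_succ_apply']
  congr 3
  refine congrArg _ (funext fun o => congrArg U ?_)
  rcases o with _ | ⟨k, c⟩
  · rfl
  · simp only [SimState.resume, Option.map_some, idleHistory, Function.iterate_succ_apply']
    rw [add_assoc, add_comm 1]

end Policy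

/-- The cost of `n` idle slots. -/
noncomputable def idleCost (w : State × Action → ℕ) (n : ℕ) (s : State) : ℝ≥0∞ :=
  ∑ i ∈ Finset.range n, (w (afterIdle^[i] s, .idle) : ℝ≥0∞)

theorem idleCost_succ' (w : State × Action → ℕ) (n : ℕ) (s : State) :
    idleCost w (n + 1) s = w (s, .idle) + idleCost w n (afterIdle s) := by
  rw [idleCost, Finset.sum_range_succ', add_comm]
  rfl

/-- `A n d s` bounds the excess of the cost of `n` slots of the simulation over the cost of `n - d`
slots of the simulated policy, if the latter is `d` slots ahead and the true state is `s`. -/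
structure IsExcess (ch : Channel) (w : State × Action → ℕ) (A : ℕ → ℕ → State → ℝ≥0∞) : Prop where
  idleRun : ∀ n d s, n ≤ d → idleCost w n s ≤ A n d s
  idle : ∀ n d s, d < n → A n (d + 1) s ≤ A n d s + w (afterIdle^[d] s, .idle)
  fresh : ∀ m d s s', idleCost w d s + A m 0 s' ≤ A (d + m + 1) d s
  retransmit : ∀ n d s s', d ≤ n → s.pktAge ≤ s.aoi → s.r ≠ 0 →
    s' ∈ (ch.step s .retransmit).support →
      w (s, .retransmit) + A n d s' ≤ w (afterIdle^[d] s, .retransmit) + A (n + 1) d s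
  -- Here the simulated policy has no slots left, and `d'` is the lag after the draw. The outcome is
  -- averaged, unlike in `retransmit`, because the extra retransmissions are controlled only in
  -- expectation.
  retransmit_late : ∀ n d d' s, n < d → n < d' → s.pktAge ≤ s.aoi → s.r ≠ 0 →
    w (s, .retransmit) + expect (ch.step s .retransmit) (A n d') ≤ A (n + 1) d s

/-! ### Induction comparing the simulation with the simulated policy -/

namespace Policy

variable (ch : Channel) (π : Policy) (w : State × Action → ℕ)

/-- The expected cost of `n` slots of a policy from a given history and state on. -/
noncomputable def value (n : ℕ) (h : History) (s : State) : ℝ≥0∞ :=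
  costToGo (π.kernel ch) (fun p => expect (π.act p.1 p.2) fun a => (w (p.2, a) : ℝ≥0∞)) n (h, s)

theorem value_succ (n : ℕ) (h : History) (s : State) :
    π.value ch w (n + 1) h s = expect (π.act h s) fun a =>
      w (s, a) + expect (ch.step s a) fun s' => π.value ch w n ((s, a) :: h) s' := by
  rw [value, costToGo, expect_add, kernel, expect_bind]
  simp only [expect_map]
  rfl

/-- The expected cost of `n` slots of the simulation. -/
noncomputable def simValue (n : ℕ) (y : SimState) : ℝ≥0∞ :=
  costToGo (π.simKernel ch) (fun y => (w (y.st, y.action) : ℝ≥0∞)) n y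

theorem simValue_succ (n : ℕ) (y : SimState) :
    π.simValue ch w (n + 1) y = w (y.st, y.action) +
      expect (ch.step y.st y.action) fun s' => expect (π.update y s') (π.simValue ch w n) := by
  rw [simValue, costToGo, simKernel, expect_bind]
  rfl

theorem simValue_idle (n : ℕ) : ∀ hv d h s,
    π.simValue ch w n ⟨hv, d, .idle, h, s⟩ = idleCost w n s := by
  induction n with
  | zero => intros; simp [simValue, costToGo, idleCost]
  | succ n ih =>
    intro hv d h s
    rw [simValue_succ, idleCost_succ']
    simp only [SimState.action, Channel.step, update, expect_pure, ih]

theorem simValue_fresh_of_le (n : ℕ) : ∀ hv d h s, n ≤ d →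
    π.simValue ch w n ⟨hv, d, .fresh, h, s⟩ = idleCost w n s := by
  induction n with
  | zero => intros; simp [simValue, costToGo, idleCost]
  | succ n ih =>
    rintro hv (_ | d) h s hd
    · omega
    · rw [simValue_succ, idleCost_succ']
      simp only [SimState.action, Channel.step, update, expect_pure, ih _ _ _ _ (by omega : n ≤ d)]

/-- Waiting out the lag brings the true state to the simulated one. The true history plays no role
afterwards, so `h'` is left unspecified. -/
theorem simValue_fresh_add (m : ℕ) (hv : History) (d : ℕ) : ∀ h s, ∃ h',
    π.simValue ch w (d + m) ⟨hv, d, .fresh, h, s⟩ =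
      idleCost w d s + π.simValue ch w m ⟨hv, 0, .fresh, h', afterIdle^[d] s⟩ := by
  induction d with
  | zero => intro h s; exact ⟨h, by simp [idleCost]⟩
  | succ d ih =>
    intro h s
    obtain ⟨h', hh⟩ := ih ((s, .idle) :: h) (afterIdle s)
    refine ⟨h', ?_⟩
    rw [add_right_comm, simValue_succ, idleCost_succ', add_assoc]
    simp only [SimState.action, Channel.step, update, expect_pure, hh]
    rfl

variable {ch w} {A : ℕ → ℕ → State → ℝ≥0∞}

/-- The simulated policy has used up its horizon. A draw never shortens the lag before a new packet,
so none is sent in the remaining slots, and only retransmissions can cost more than idling. -/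
theorem simValue_le_of_lag (hA : IsExcess ch w A) {n : ℕ}
    (ih : ∀ n' < n, ∀ hv d h s, s.pktAge ≤ s.aoi →
      expect (π.draw hv d h s) (π.simValue ch w n') ≤
        A n' d s + π.value ch w (n' - d) hv (afterIdle^[d] s))
    {hv : History} {d : ℕ} {h : History} {s : State} (hs : s.pktAge ≤ s.aoi) (hd : n ≤ d) :
    expect (π.draw hv d h s) (π.simValue ch w n) ≤ A n d s := by
  rw [← expect_const (π.draw hv d h s) (A n d s)]
  refine expect_mono fun y hy => ?_
  obtain ⟨h1, h2, h3, h4⟩ := π.mem_support_draw hy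
  obtain ⟨hv', d', c, h', s'⟩ := y
  obtain rfl : h' = h := h1
  obtain rfl : s' = s := h2
  cases c with
  | idle => rw [simValue_idle]; exact hA.idleRun _ _ _ hd
  | fresh =>
    have : d ≤ d' := by simpa using h3
    rw [simValue_fresh_of_le _ _ _ _ _ _ _ _ (hd.trans this)]
    exact hA.idleRun _ _ _ hd
  | retransmit =>
    have hdd : d ≤ d' := by simpa using h3
    cases n with
    | zero => simp [simValue, costToGo]
    | succ n =>
      rw [simValue_succ]
      refine le_trans ?_ (hA.retransmit_late n d d' s' (by omega) (by omega) hs (h4 rfl))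
      refine add_le_add le_rfl (expect_mono fun s'' hs'' => ?_)
      refine (ih n (by omega) _ _ _ _ (pktAge_le_aoi_of_mem_support_step hs hs'')).trans ?_
      rw [Nat.sub_eq_zero_of_le (by omega)]
      simp [value, costToGo]

/-- Strong induction on the true slots `n` handles transmissions. A simulated idle slot leaves `n`
unchanged and only increases the lag, hence the inner induction on a bound `m` for the slots left to
the simulated policy. -/
theorem expect_draw_simValue_le (hA : IsExcess ch w A) (n : ℕ) :
    ∀ hv d h s, s.pktAge ≤ s.aoi →
      expect (π.draw hv d h s) (π.simValue ch w n) ≤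
        A n d s + π.value ch w (n - d) hv (afterIdle^[d] s) := by
  induction n using Nat.strong_induction_on with
  | _ n ih =>
  suffices H : ∀ m d, n ≤ d + m → ∀ hv h s, s.pktAge ≤ s.aoi →
      expect (π.draw hv d h s) (π.simValue ch w n) ≤
        A n d s + π.value ch w (n - d) hv (afterIdle^[d] s) from
    fun hv d h s hs => H n d (by omega) hv h s hs
  intro m
  induction m with
  | zero =>
    intro d hd hv h s hs
    exact (π.simValue_le_of_lag hA ih hs hd).trans le_self_add
  | succ m ihm =>
    intro d hd hv h s hs
    by_cases hnd : n ≤ d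
    · exact (π.simValue_le_of_lag hA ih hs hnd).trans le_self_add
    obtain ⟨e, rfl⟩ : ∃ e, n = d + e + 1 := ⟨n - d - 1, by omega⟩
    rw [expect_draw_rec, show d + e + 1 - d = e + 1 by omega, value_succ, ← expect_const_add,
      expect_action]
    refine add_le_add (add_le_add (mul_le_mul_right ?_ _) (mul_le_mul_right ?_ _)) ?_
    · refine (ihm (d + 1) (by omega) _ _ _ hs).trans ?_
      rw [← add_assoc, show d + e + 1 - (d + 1) = e by omega]
      refine add_le_add (hA.idle _ _ _ (by omega)) ?_
      rw [Channel.step, expect_pure, Function.iterate_succ_apply']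
    -- Of the `d + e + 1` slots, `d` are spent catching up and one on the new packet; the lag is
    -- then zero.
    · obtain ⟨h', hh⟩ := π.simValue_fresh_add ch w (e + 1) hv d h s
      rw [add_assoc, hh, simValue_succ, add_left_comm (idleCost w d s), add_left_comm (A _ _ _)]
      refine add_le_add le_rfl ?_
      simp only [SimState.action, update]
      rw [← expect_const_add, ← expect_const_add]
      refine expect_mono fun s' hs' => ?_
      refine (add_le_add le_rfl (ih e (by omega) _ _ _ _
        (pktAge_le_aoi_of_mem_support_step (pktAge_le_aoi_iterate_afterIdle hs d) hs'))).trans ?_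
      rw [← add_assoc]
      exact add_le_add (hA.fresh e d s s') le_rfl
    · by_cases hr : s.r = 0
      · rw [π.admissible _ _ (by rwa [r_iterate_afterIdle]), zero_mul]
        exact zero_le
      refine mul_le_mul_right ?_ _
      rw [simValue_succ]
      simp only [SimState.action, update]
      -- Couples the two retransmissions: the simulated outcome is the true outcome after `d` idle
      -- slots.
      rw [step_retransmit_iterate_afterIdle ch hr, expect_map, ← expect_const_add,
        ← expect_const_add, ← expect_const_add]
      refine expect_mono fun s' hs' => ?_
      refine (add_le_add le_rfl (ih (d + e) (by omega) _ _ _ _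
        (pktAge_le_aoi_of_mem_support_step hs hs'))).trans ?_
      rw [← add_assoc, ← add_assoc, show d + e - d = e by omega, add_comm (A _ _ _)]
      exact add_le_add (hA.retransmit _ _ _ _ (by omega) hs hr hs') le_rfl

end Policy

/-! ### Excess of the age and of the number of transmissions -/

theorem idleCost_aoi (n : ℕ) (s : State) :
    idleCost (fun p => p.1.aoi) n s = ((∑ i ∈ Finset.range n, (s.aoi + i) : ℕ) : ℝ≥0∞) := by
  simp [idleCost, aoi_iterate_afterIdle]

theorem idleCost_transmissions (n : ℕ) (s : State) : idleCost Policy.transmissions n s = 0 := by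
  simp [idleCost, Policy.transmissions]

theorem sum_range_aoi_add_succ (a n : ℕ) :
    ∑ i ∈ Finset.range n, (a + 1 + i) = n + ∑ i ∈ Finset.range n, (a + i) := by
  simp only [add_right_comm a 1, Finset.sum_add_distrib]
  simp; ring

/-- The age of information is not larger in the simulation. -/
theorem isExcess_aoi (ch : Channel) : IsExcess ch (fun p => p.1.aoi)
    -- The total age over the idle slots needed to catch up, cut off at the horizon; it is zero
    -- without lag.
    (fun n d s => ((∑ i ∈ Finset.range (min n d), (s.aoi + i) : ℕ) : ℝ≥0∞)) where
  idleRun n d s h := by rw [min_eq_left h, idleCost_aoi]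
  idle n d s h := by
    rw [min_eq_right h, min_eq_right h.le, aoi_iterate_afterIdle, Finset.sum_range_succ]
    exact_mod_cast le_rfl
  fresh m d s s' := by
    rw [min_eq_right (by omega : d ≤ d + m + 1), idleCost_aoi]
    simp
  retransmit n d s s' h hs hr hs' := by
    rw [min_eq_right h, min_eq_right (by omega), aoi_iterate_afterIdle]
    -- Starting from `s'` instead of `s` adds at most one to each of `d` ages; this is paid for by
    -- the delayed retransmission, whose slot has an age larger by `d`.
    have h1 : ∑ i ∈ Finset.range d, (s'.aoi + i) ≤ ∑ i ∈ Finset.range d, (s.aoi + 1 + i) :=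
      Finset.sum_le_sum fun i _ => by have := aoi_le_of_mem_support_step hs hs'; omega
    rw [sum_range_aoi_add_succ] at h1
    have : s.aoi + ∑ i ∈ Finset.range d, (s'.aoi + i) ≤
        s.aoi + d + ∑ i ∈ Finset.range d, (s.aoi + i) := by omega
    exact_mod_cast this
  retransmit_late n d d' s h h' hs hr := by
    rw [← expect_const_add]
    refine le_trans (expect_mono (g := fun _ => _) ?_) (expect_const _ _).le
    intro s' hs'
    rw [min_eq_left h'.le, min_eq_left h, Finset.sum_range_succ']
    have h1 : ∑ i ∈ Finset.range n, (s'.aoi + i) ≤ ∑ i ∈ Finset.range n, (s.aoi + (i + 1)) :=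
      Finset.sum_le_sum fun i _ => by have := aoi_le_of_mem_support_step hs hs'; omega
    have : s.aoi + ∑ i ∈ Finset.range n, (s'.aoi + i) ≤
        ∑ i ∈ Finset.range n, (s.aoi + (i + 1)) + (s.aoi + 0) := by omega
    exact_mod_cast this

namespace Channel

variable (ch : Channel)

/-- A bound on the expected number of attempts until a packet is decoded. -/
noncomputable def maxAttempts : ℝ≥0 := (1 - ch.g 0)⁻¹

/-- With `M = 1 / (1 - g 0)` one has `1 + g 0 * M = M`, and `g r ≤ g 0`. -/
theorem one_add_g_mul_maxAttempts_le (r : ℕ) : 1 + ch.g r * ch.maxAttempts ≤ ch.maxAttempts := by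
  have h : 1 - ch.g 0 ≠ 0 := (tsub_pos_of_lt ch.g_zero_lt_one).ne'
  have h1 : (1 - ch.g 0) * ch.maxAttempts + ch.g 0 * ch.maxAttempts = ch.maxAttempts := by
    rw [← add_mul, tsub_add_cancel_of_le ch.g_zero_lt_one.le, one_mul]
  calc 1 + ch.g r * ch.maxAttempts
      ≤ (1 - ch.g 0) * ch.maxAttempts + ch.g 0 * ch.maxAttempts := by
        refine add_le_add ?_ (mul_le_mul_left (ch.antitone_g (Nat.zero_le r)) _)
        rw [maxAttempts, mul_inv_cancel₀ h]
    _ = ch.maxAttempts := h1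

theorem expect_attempt (r : ℕ) (f : Bool → ℝ≥0∞) :
    expect (ch.attempt r) f = ch.g r * f true + (1 - ch.g r) * f false := by
  rw [expect, tsum_fintype, Fintype.sum_bool]
  simp [attempt]

end Channel

/-- The simulation makes at most one additional burst of transmissions. -/
theorem isExcess_transmissions (ch : Channel) : IsExcess ch Policy.transmissions
    -- With no pending packet and a lag reaching the horizon, the simulation can only idle. The
    -- value zero there is what closes the recursion for `maxAttempts`.
    (fun n d s => if n ≤ d ∧ s.r = 0 then 0 else (ch.maxAttempts : ℝ≥0∞)) where
  idleRun n d s h := by rw [idleCost_transmissions]; exact zero_le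
  idle n d s h := by
    rw [if_neg (by omega : ¬(n ≤ d ∧ s.r = 0))]
    split_ifs <;> simp
  fresh m d s s' := by
    rw [if_neg (by omega : ¬(d + m + 1 ≤ d ∧ s.r = 0)), idleCost_transmissions]
    split_ifs <;> simp
  retransmit n d s s' h hs hr hs' := by
    rw [if_neg (by omega : ¬(n + 1 ≤ d ∧ s.r = 0))]
    refine add_le_add le_rfl ?_
    split_ifs <;> simp
  retransmit_late n d d' s h h' hs hr := by
    rw [if_neg (by omega : ¬(n + 1 ≤ d ∧ s.r = 0)), Channel.step, expect_map,
      Channel.expect_attempt]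
    simp only [h'.le, true_and, if_true, Bool.false_eq_true, if_false, mul_zero, add_zero,
      Policy.transmissions, Nat.cast_one]
    -- A success leaves no excess, so only the failure branch, of weight `g s.r`, contributes
    -- another `maxAttempts`.
    refine le_trans (add_le_add le_rfl (mul_le_mul_right (c := (ch.maxAttempts : ℝ≥0∞)) ?_ _))
      (by exact_mod_cast ch.one_add_g_mul_maxAttempts_le s.r)
    split_ifs <;> simp

/-! ### Long-run averages and conclusion -/

theorem limsup_div_le_of_le_add_const {a b : ℕ → ℝ≥0∞} {K : ℝ≥0} (h : ∀ T, a T ≤ K + b T) :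
    Filter.limsup (fun T : ℕ => a T / (T : ℝ≥0∞)) Filter.atTop ≤
      Filter.limsup (fun T : ℕ => b T / (T : ℝ≥0∞)) Filter.atTop := by
  have hK : Filter.Tendsto (fun T : ℕ => (K : ℝ≥0∞) / (T : ℝ≥0∞)) Filter.atTop (nhds 0) := by
    simpa using ENNReal.Tendsto.const_div ENNReal.tendsto_nat_nhds_top (.inr ENNReal.coe_ne_top)
  refine ENNReal.le_of_forall_pos_le_add fun ε hε _ => ?_
  rw [← limsup_add_const Filter.atTop _ (ε : ℝ≥0∞) (by isBoundedDefault) (by isBoundedDefault)]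
  refine Filter.limsup_le_limsup ?_
  filter_upwards [hK.eventually_le_const (ENNReal.coe_pos.2 hε)] with T hT
  calc a T / T ≤ (K + b T) / T := ENNReal.div_le_div_right (h T) _
    _ = b T / T + K / T := by rw [ENNReal.add_div, add_comm]
    _ ≤ _ := add_le_add le_rfl hT

namespace Policy

theorem expectedCost_le {ch : Channel} {π π' : Policy}
    (h : ∀ T, π'.law ch T = (π.simLaw ch T).map SimState.past) {w : State × Action → ℕ}
    {A : ℕ → ℕ → State → ℝ≥0∞} (hA : IsExcess ch w A) (T : ℕ) :
    π'.expectedCost ch (total w) T ≤ A T 0 State.init + π.expectedCost ch (total w) T := by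
  rw [π.expectedCost_eq_of_law_eq ch h, π.expectedCost_eq]
  exact π.expect_draw_simValue_le hA T [] 0 [] State.init (by simp [State.init])

theorem prob_eq_zero {ch : Channel} {π π' : Policy}
    (h : ∀ T, π'.law ch T = (π.simLaw ch T).map SimState.past) (T : ℕ) {E : History → Prop}
    (hE : ∀ h, E h → LastIsRetransmission h ∧ ¬ PreviousTransmissionFailed h) :
    π'.prob ch T E = 0 := by
  rw [prob, PMF.toOuterMeasure_apply_eq_zero_iff, h, Set.disjoint_left]
  intro p hp hpE
  obtain ⟨y, hy, rfl⟩ := (PMF.mem_support_map_iff _ _ _).1 hp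
  obtain ⟨h1, h2⟩ := hE _ hpE
  exact h2 ((π.simInvariant_of_mem_support_simLaw ch T y hy).hist h1)

end Policy

end HARQ

theorem propositionp1 (ch : HARQ.Channel) (π : HARQ.Policy) :
    ∃ π' : HARQ.Policy,
      π'.averageAge ch ≤ π.averageAge ch ∧
      π'.averageTransmissions ch ≤ π.averageTransmissions ch ∧
      (∀ T : ℕ, π'.prob ch T
        (fun h => HARQ.LastIsRetransmission h ∧ ¬ HARQ.PreviousTransmissionFailed h) = 0) ∧
      (∀ T : ℕ, π'.prob ch T HARQ.IdleThenRetransmit = 0) := by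
  obtain ⟨π', h⟩ := π.exists_policy_of_simLaw ch
  refine ⟨π', ?_, ?_, fun T => HARQ.Policy.prob_eq_zero h T fun _ hh => hh,
    fun T => HARQ.Policy.prob_eq_zero h T ?_⟩
  -- The simulation starts without lag, so the age has no excess at any horizon.
  · refine HARQ.limsup_div_le_of_le_add_const (K := 0) fun T => ?_
    refine (HARQ.Policy.expectedCost_le h (HARQ.isExcess_aoi ch) T).trans (le_of_eq ?_)
    rw [Nat.min_zero, Finset.sum_range_zero, Nat.cast_zero]
    rfl
  · refine HARQ.limsup_div_le_of_le_add_const (K := ch.maxAttempts) fun T => ?_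
    refine (HARQ.Policy.expectedCost_le h (HARQ.isExcess_transmissions ch) T).trans ?_
    refine add_le_add ?_ le_rfl
    split_ifs <;> simp
  · rintro _ ⟨s, s', h', rfl⟩
    refine ⟨⟨s', _, rfl⟩, ?_⟩
    rintro ⟨s₁, s₂, a, a', h₁, hh, ha, -⟩
    simp only [List.cons.injEq, Prod.mk.injEq] at hh
    exact ha hh.2.1.2.symm
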